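/- Theorem 4.12. For a real Banach lattice $E$ the following statements are equivalent: 1. $E$ is finite dimensional. 2. Every positive disjointly weakly compact operator $T:E\to\ell_\infty$ is $M$-weakly compact. Here $\ell_\infty$ is the Banach lattice of bounded real sequences with the supremum norm and the coordinatewise order, and operators are bounded and linear. An operator $T$ is positive if $Tx\ge 0$ whenever $x\ge 0$. A sequence $(x_n)$ in a Banach lattice is disjoint if $|x_m|\wedge|x_n|=0$ for all $m\neq n$. The operator $T:E\to\ell_\infty$ is disjointly weakly compact if every disjoint sequence in the solid hull $\{y\in\ell_\infty:\ |y|\le|Tx|\text{ for some }x\in E\text{ with }\|x\|\le 1\}$ of the image of the closed unit ball of $E$ converges weakly to $0$. The operator $T$ is $M$-weakly compact if $\|Tx_n\|\to 0$ for every norm bounded disjoint sequence $(x_n)$ in $E$. -/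

import Mathlib

open Filter Topology
open scoped BoundedContinuousFunction

/-- The Banach space `ℓ_∞` of all bounded real sequences with the supremum norm and the
coordinatewise order: all real functions on `ℕ` (discrete) that are bounded. -/
abbrev EllInfty : Type := ℕ →ᵇ ℝ

/-- The order of `ℓ_∞` is a vector space order. Together with Mathlib's instances this makes
`ℓ_∞` a Banach lattice. -/
instance EllInfty.instIsOrderedModule : IsOrderedModule ℝ EllInfty where
  smul_le_smul_of_nonneg_left _ ha _ _ hfg := fun n => mul_le_mul_of_nonneg_left (hfg n) ha
  smul_le_smul_of_nonneg_right _ hf _ _ hab := fun n => mul_le_mul_of_nonneg_right hab (hf n)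

section BanachLattice

variable {E : Type*} [NormedAddCommGroup E] [Lattice E]

/-- A sequence is disjoint if `|x m| ⊓ |x n| = 0` for all `m ≠ n`. -/
def IsDisjointSeq (x : ℕ → E) : Prop :=
  ∀ ⦃m n : ℕ⦄, m ≠ n → |x m| ⊓ |x n| = 0

variable [NormedSpace ℝ E]

/-- A sequence is weakly null if it converges to `0` in the weak topology. -/
def IsWeaklyNull (x : ℕ → E) : Prop :=
  Tendsto (fun n => toWeakSpace ℝ E (x n)) atTop (𝓝 0)

/-- A set is disjointly weakly compact if it is norm bounded and every disjoint sequence in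
its solid hull `{y | ∃ a ∈ A, |y| ≤ |a|}` is weakly null. -/
def IsDisjointlyWeaklyCompactSet (A : Set E) : Prop :=
  Bornology.IsBounded A ∧
    ∀ x : ℕ → E, IsDisjointSeq x →
      (∀ n, x n ∈ LatticeOrderedAddCommGroup.solidClosure A) → IsWeaklyNull x

/-- A bounded operator into a Banach lattice is disjointly weakly compact if the image of the
closed unit ball is disjointly weakly compact. -/
def IsDisjointlyWeaklyCompact {X : Type*} [NormedAddCommGroup X] [NormedSpace ℝ X]
    (T : X →L[ℝ] E) : Prop :=
  IsDisjointlyWeaklyCompactSet (T '' Metric.closedBall (0 : X) 1)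

/-- A bounded operator from a Banach lattice is M-weakly compact if it maps every norm bounded
disjoint sequence to a norm null sequence. -/
def IsMWeaklyCompact {X : Type*} [NormedAddCommGroup X] [NormedSpace ℝ X]
    (T : E →L[ℝ] X) : Prop :=
  ∀ x : ℕ → E, Bornology.IsBounded (Set.range x) → IsDisjointSeq x →
    Tendsto (fun n => ‖T (x n)‖) atTop (𝓝 0)

/-- An operator between Banach lattices is positive if it maps positive vectors to positive
vectors. -/
def IsPositiveOperator {F : Type*} [NormedAddCommGroup F] [NormedSpace ℝ F] [Lattice F]
    (T : E →L[ℝ] F) : Prop :=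
  ∀ x : E, 0 ≤ x → 0 ≤ T x

end BanachLattice

/-! Bounded disjoint sequences in `ℓ_∞` are weakly null, so every bounded operator into `ℓ_∞` is
disjointly weakly compact, and the second condition says that every positive operator is M-weakly
compact. In finite dimension this holds because nonzero disjoint vectors are independent, so
disjoint sequences are eventually zero. In infinite dimension `exists_isDisjointSeq_norm_eq_one`
gives positive disjoint unit vectors; positive contractive functionals norming them are the
coordinates of a positive operator `T` with `‖T (x n)‖ ≥ 1`. -/

theorem add_inf_le_inf_add_inf {E : Type*} [NormedAddCommGroup E] [Lattice E] [IsOrderedAddMonoid E]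
    {a b x : E} (ha : 0 ≤ a) (hb : 0 ≤ b) (hx : 0 ≤ x) :
    (a + b) ⊓ x ≤ a ⊓ x + b ⊓ x := by
  have h1 : (a + b) ⊓ x - a ⊓ x ≤ b := by
    rw [sub_le_iff_le_add, add_inf]
    exact le_inf (inf_le_left.trans (add_comm a b).le)
      (inf_le_right.trans (le_add_of_nonneg_left hb))
  have h2 : (a + b) ⊓ x - a ⊓ x ≤ x :=
    (sub_le_self _ (le_inf ha hx)).trans inf_le_right
  exact sub_le_iff_le_add'.mp (le_inf h1 h2)

/-! ### Disjoint vectors and linear independence. -/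

section Disjointness

variable {E : Type*} [NormedAddCommGroup E] [Lattice E]

theorem inf_eq_zero_of_le {a b c d : E} (ha : 0 ≤ a) (hb : 0 ≤ b) (hac : a ≤ c) (hbd : b ≤ d)
    (h : c ⊓ d = 0) : a ⊓ b = 0 :=
  le_antisymm (h ▸ inf_le_inf hac hbd) (le_inf ha hb)

variable [NormedSpace ℝ E] [IsOrderedModule ℝ E]

theorem abs_smul_le_smul_abs (c : ℝ) (y : E) : |c • y| ≤ |c| • |y| := by
  have h : ∀ z : E, |z| = |y| → |c| • z ≤ |c| • |y| := fun z hz =>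
    smul_le_smul_of_nonneg_left (hz ▸ le_abs_self z) (abs_nonneg c)
  have h1 := h y rfl
  have h2 := h (-y) (abs_neg y)
  rw [smul_neg] at h2
  rcases abs_choice c with hc | hc
  · nth_rewrite 1 [hc] at h1 h2
    exact abs_le'.mpr ⟨h1, h2⟩
  · nth_rewrite 1 [hc] at h1 h2
    rw [neg_smul] at h1 h2
    rw [neg_neg] at h2
    exact abs_le'.mpr ⟨h2, h1⟩

variable [IsOrderedAddMonoid E]

theorem smul_inf_eq_zero {c : ℝ} (hc : 0 ≤ c) {a x : E} (ha : 0 ≤ a) (hx : 0 ≤ x)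
    (h : a ⊓ x = 0) : (c • a) ⊓ x = 0 := by
  refine le_antisymm ?_ (le_inf (smul_nonneg hc ha) hx)
  -- `K` dominates both `c` and `1`, so `c • a ≤ K • a` and `x ≤ K • x`.
  set K := max c 1
  have hK : 0 < K := lt_of_lt_of_le one_pos (le_max_right _ _)
  have hle : (c • a) ⊓ x ≤ K • (a ⊓ x) := by
    rw [← inv_smul_le_iff_of_pos hK]
    refine le_inf ((inv_smul_le_iff_of_pos hK).mpr (inf_le_left.trans ?_))
      ((inv_smul_le_iff_of_pos hK).mpr (inf_le_right.trans ?_))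
    · exact smul_le_smul_of_nonneg_right (le_max_left _ _) ha
    · simpa using smul_le_smul_of_nonneg_right (le_max_right c 1) hx
  simpa [h] using hle

/-- The disjoint complement of a vector, as a linear subspace. -/
def disjointComplement (x : E) : Submodule ℝ E where
  carrier := {y | |y| ⊓ |x| = 0}
  zero_mem' := by simp
  add_mem' {y z} hy hz := by
    have hy' : |y| ⊓ |x| = 0 := hy
    have hz' : |z| ⊓ |x| = 0 := hz
    refine le_antisymm ?_ (le_inf (abs_nonneg _) (abs_nonneg _))
    calc |y + z| ⊓ |x| ≤ (|y| + |z|) ⊓ |x| := inf_le_inf_right _ (abs_add_le y z)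
      _ ≤ |y| ⊓ |x| + |z| ⊓ |x| :=
        add_inf_le_inf_add_inf (abs_nonneg _) (abs_nonneg _) (abs_nonneg _)
      _ = 0 := by rw [hy', hz', add_zero]
  smul_mem' c y hy := by
    exact inf_eq_zero_of_le (abs_nonneg _) (abs_nonneg _) (abs_smul_le_smul_abs c y) le_rfl
      (smul_inf_eq_zero (abs_nonneg c) (abs_nonneg _) (abs_nonneg _) hy)

/-- The other terms span a subspace of the disjoint complement of `x i`, and only zero is disjoint
from itself. -/
theorem IsDisjointSeq.linearIndependent {x : ℕ → E} (hx : IsDisjointSeq x) :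
    LinearIndependent ℝ (fun n : {n // x n ≠ 0} => x n) := by
  rw [linearIndependent_iff_notMem_span]
  rintro i hi
  have hle : Submodule.span ℝ ((fun n : {n // x n ≠ 0} => x n) '' (Set.univ \ {i})) ≤
      disjointComplement (x i) := by
    rw [Submodule.span_le]
    rintro _ ⟨j, hj, rfl⟩
    exact hx fun h => hj.2 (Subtype.ext h)
  have h : |x i| ⊓ |x i| = 0 := hle hi
  rw [inf_idem] at h
  exact i.2 (le_antisymm ((le_abs_self _).trans h.le)
    (neg_nonpos.mp ((neg_le_abs _).trans h.le)))

theorem IsDisjointSeq.eventually_eq_zero [FiniteDimensional ℝ E] {x : ℕ → E}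
    (hx : IsDisjointSeq x) : ∀ᶠ n in atTop, x n = 0 := by
  have hfin : Finite {n // x n ≠ 0} := hx.linearIndependent.finite
  have hs : {n | x n ≠ 0}.Finite := Set.finite_coe_iff.mp hfin
  rw [← Nat.cofinite_eq_atTop]
  filter_upwards [hs.compl_mem_cofinite] with n hn
  simpa using hn

end Disjointness

/-! ### Atoms and infinite disjoint sequences. -/

section Atoms

variable {E : Type*} [NormedAddCommGroup E] [Lattice E]

/-- A positive vector that does not dominate two disjoint nonzero positive vectors. -/
def IsLatticeAtom (a : E) : Prop :=
  0 < a ∧ ∀ y z : E, 0 ≤ y → 0 ≤ z → y ≤ a → z ≤ a → y ⊓ z = 0 → y = 0 ∨ z = 0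

/-- Split a non-atom into two disjoint pieces, keep one as the next term and split the other again;
it still lies below `x`. -/
theorem exists_disjoint_seq_of_forall_not_isLatticeAtom {x : E} (hx : 0 < x)
    (h : ∀ a ≤ x, ¬ IsLatticeAtom a) :
    ∃ y : ℕ → E, (∀ n, 0 < y n) ∧ ∀ m n, m < n → y m ⊓ y n = 0 := by
  have step : ∀ z : {z : E // 0 < z ∧ z ≤ x}, ∃ p : E × {z : E // 0 < z ∧ z ≤ x},
      0 < p.1 ∧ p.1 ≤ z ∧ (p.2 : E) ≤ z ∧ p.1 ⊓ p.2 = 0 := by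
    rintro ⟨z, hz, hzx⟩
    have hz' := h z hzx
    simp only [IsLatticeAtom, not_and, not_forall, not_or] at hz'
    obtain ⟨y, w, hy, hw, hyz, hwz, hyw, hy0, hw0⟩ := hz' hz
    exact ⟨(y, ⟨w, hw.lt_of_ne' hw0, hwz.trans hzx⟩), hy.lt_of_ne' hy0, hyz, hwz, hyw⟩
  choose p hp0 hpz hpz' hpd using step
  let z : ℕ → {z : E // 0 < z ∧ z ≤ x} := fun n => (fun w => (p w).2)^[n] ⟨x, hx, le_rfl⟩
  have hzs : ∀ n, z (n + 1) = (p (z n)).2 := fun n => Function.iterate_succ_apply' _ _ _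
  have hanti : Antitone fun n => (z n : E) :=
    antitone_nat_of_succ_le fun n => by rw [hzs]; exact hpz' _
  refine ⟨fun n => (p (z n)).1, fun n => hp0 _, fun m n hmn => ?_⟩
  refine le_antisymm ?_ (le_inf (hp0 _).le (hp0 _).le)
  refine (inf_le_inf_left _ ((hpz _).trans (hanti (Nat.succ_le_of_lt hmn)))).trans ?_
  change (p (z m)).1 ⊓ (z (m + 1) : E) ≤ 0
  rw [hzs, hpd]

variable [IsOrderedAddMonoid E] [HasSolidNorm E]

theorem norm_le_norm_of_nonneg_of_le {x y : E} (hx : 0 ≤ x) (hxy : x ≤ y) : ‖x‖ ≤ ‖y‖ :=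
  norm_le_norm_of_abs_le_abs (by rwa [abs_of_nonneg hx, abs_of_nonneg (hx.trans hxy)])

variable [NormedSpace ℝ E] [IsOrderedModule ℝ E]

theorem exists_isGreatest_smul_le {a u : E} (ha : 0 < a) (hu : 0 ≤ u) :
    ∃ t : ℝ, IsGreatest {s : ℝ | s • a ≤ u} t := by
  have hne : ({s : ℝ | s • a ≤ u}).Nonempty := ⟨0, by simpa using hu⟩
  have hbdd : BddAbove {s : ℝ | s • a ≤ u} := by
    refine ⟨‖u‖ / ‖a‖, fun s hs => ?_⟩
    have ha' : 0 < ‖a‖ := norm_pos_iff.mpr ha.ne'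
    rcases le_total s 0 with h0 | h0
    · exact h0.trans (by positivity)
    · rw [le_div_iff₀ ha']
      have := norm_le_norm_of_nonneg_of_le (smul_nonneg h0 ha.le) hs
      rwa [norm_smul, Real.norm_of_nonneg h0] at this
  have hclosed : IsClosed {s : ℝ | s • a ≤ u} :=
    isClosed_le (continuous_id.smul continuous_const) continuous_const
  exact ⟨_, hclosed.csSup_mem hne hbdd, fun s hs => le_csSup hbdd hs⟩

theorem IsLatticeAtom.exists_eq_smul {a u : E} (ha : IsLatticeAtom a) (hu : 0 ≤ u)
    (hua : u ≤ a) : ∃ t : ℝ, u = t • a := by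
  obtain ⟨t, ht, htmax⟩ := exists_isGreatest_smul_le ha.1 hu
  have ht' : t • a ≤ u := ht
  have ht0 : 0 ≤ t := htmax (by simpa using hu : (0 : ℝ) • a ≤ u)
  refine ⟨t, sub_eq_zero.mp (le_antisymm ?_ (sub_nonneg.mpr ht'))⟩
  have hva : u - t • a ≤ a := (sub_le_self _ (smul_nonneg ht0 ha.1.le)).trans hua
  -- The positive and negative parts of `u - t • a - ε • a` are disjoint and below the atom, so one
  -- vanishes; maximality of `t` excludes the negative one.
  have key : ∀ ε ∈ Set.Ioc (0 : ℝ) 1, u - t • a ≤ ε • a := by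
    rintro ε ⟨hε, hε1⟩
    have hεa : 0 ≤ ε • a := smul_nonneg hε.le ha.1.le
    have hεa1 : ε • a ≤ a := by simpa using smul_le_smul_of_nonneg_right hε1 ha.1.le
    set v := u - t • a with hv
    have hv0 : 0 ≤ v := sub_nonneg.mpr ht'
    have hpos : (v - ε • a)⁺ ≤ a :=
      sup_le ((sub_le_self _ hεa).trans hva) ha.1.le
    have hneg : (v - ε • a)⁻ ≤ a := by
      refine sup_le ?_ ha.1.le
      rw [neg_sub]
      exact (sub_le_self _ hv0).trans hεa1
    rcases ha.2 _ _ (posPart_nonneg _) (negPart_nonneg _) hpos hneg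
      (posPart_inf_negPart_eq_zero _) with h | h
    · exact sub_nonpos.mp (posPart_eq_zero.mp h)
    · have h1 : ε • a ≤ u - t • a := sub_nonneg.mp (negPart_eq_zero.mp h)
      have h2 : (t + ε) • a ≤ u := by
        rw [add_smul]
        exact le_sub_iff_add_le'.mp h1
      have : t + ε ≤ t := htmax h2
      linarith
  have hlim : Tendsto (fun ε : ℝ => ε • a) (𝓝[>] 0) (𝓝 0) := by
    have : Tendsto (fun ε : ℝ => ε • a) (𝓝 0) (𝓝 ((0 : ℝ) • a)) :=
      (continuous_id.smul continuous_const).tendsto 0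
    rw [zero_smul] at this
    exact this.mono_left nhdsWithin_le_nhds
  refine ge_of_tendsto hlim ?_
  filter_upwards [Ioc_mem_nhdsGT (zero_lt_one (α := ℝ))] with ε hε using key ε hε

/-- Subtract the greatest possible multiple of each atom in turn: a remainder still meeting that
atom would contain a further multiple of it. -/
theorem exists_mem_span_sub_disjoint (s : Finset E) (hs : ∀ a ∈ s, IsLatticeAtom a) {u : E}
    (hu : 0 ≤ u) : ∃ v ∈ Submodule.span ℝ (s : Set E), v ≤ u ∧ ∀ a ∈ s, a ⊓ (u - v) = 0 := by
  classical
  induction s using Finset.induction_on with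
  | empty => exact ⟨0, zero_mem _, hu, by simp⟩
  | insert a s has ih =>
    obtain ⟨v, hv, hvu, hd⟩ := ih fun b hb => hs b (Finset.mem_insert_of_mem hb)
    have ha := hs a (Finset.mem_insert_self a s)
    have hw : 0 ≤ u - v := sub_nonneg.mpr hvu
    obtain ⟨t, ht, htmax⟩ := exists_isGreatest_smul_le ha.1 hw
    have ht' : t • a ≤ u - v := ht
    have ht0 : 0 ≤ t := htmax (by simpa using hw : (0 : ℝ) • a ≤ u - v)
    have hta : 0 ≤ t • a := smul_nonneg ht0 ha.1.le
    have hr : 0 ≤ u - (v + t • a) := by rw [← sub_sub]; exact sub_nonneg.mpr ht'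
    refine ⟨v + t • a, add_mem ?_ ?_, sub_nonneg.mp hr, fun b hb => ?_⟩
    · exact Submodule.span_mono (by simp) hv
    · exact Submodule.smul_mem _ _ (Submodule.subset_span (by simp))
    rcases Finset.mem_insert.mp hb with rfl | hb
    · have h0 : 0 ≤ b ⊓ (u - (v + t • b)) := le_inf ha.1.le hr
      obtain ⟨c, hc⟩ := ha.exists_eq_smul h0 inf_le_left
      have h1 : c • b ≤ u - v - t • b := by
        rw [← hc, sub_sub]
        exact inf_le_right
      have h2 : (t + c) • b ≤ u - v := by
        rw [add_smul]
        exact le_sub_iff_add_le'.mp h1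
      have h3 : t + c ≤ t := htmax h2
      refine le_antisymm ?_ h0
      rw [hc]
      exact smul_nonpos_of_nonpos_of_nonneg (by linarith) ha.1.le
    · refine inf_eq_zero_of_le (hs b (Finset.mem_insert_of_mem hb)).1.le hr le_rfl ?_ (hd b hb)
      rw [← sub_sub]
      exact sub_le_self _ hta

theorem exists_disjoint_seq_pos (hE : ¬ FiniteDimensional ℝ E) :
    ∃ y : ℕ → E, (∀ n, 0 < y n) ∧ ∀ m n, m < n → y m ⊓ y n = 0 := by
  by_cases hatom : ∀ x : E, 0 < x → ∃ a ≤ x, IsLatticeAtom a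
  · obtain ⟨y, hy, hd⟩ := exists_seq_of_forall_finset_exists (IsLatticeAtom (E := E))
      (fun a b => a ⊓ b = 0) fun s hs => by
        by_contra hcon
        push Not at hcon
        -- Every atom now meets some member of `s`, so a remainder disjoint from `s` dominates no
        -- atom and is zero. Thus `s` spans `E`.
        refine hE ?_
        have hpos : ∀ u : E, 0 ≤ u → u ∈ Submodule.span ℝ (s : Set E) := by
          intro u hu
          obtain ⟨v, hv, hvu, hd⟩ := exists_mem_span_sub_disjoint s hs hu
          rcases (sub_nonneg.mpr hvu).eq_or_lt with h | h
          · rwa [sub_eq_zero.mp h.symm]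
          · obtain ⟨b, hbw, hb⟩ := hatom _ h
            obtain ⟨a, has, hab⟩ := hcon b hb
            exact absurd (inf_eq_zero_of_le (hs a has).1.le hb.1.le le_rfl hbw (hd a has)) hab
        refine Module.Finite.of_fg_top ⟨s, eq_top_iff.mpr fun u _ => ?_⟩
        rw [← posPart_sub_negPart u]
        exact sub_mem (hpos _ (posPart_nonneg u)) (hpos _ (negPart_nonneg u))
    exact ⟨y, fun n => (hy n).1, hd⟩
  · push Not at hatom
    obtain ⟨x, hx, h⟩ := hatom
    exact exists_disjoint_seq_of_forall_not_isLatticeAtom hx h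

theorem exists_isDisjointSeq_norm_eq_one (hE : ¬ FiniteDimensional ℝ E) :
    ∃ x : ℕ → E, (∀ n, 0 ≤ x n) ∧ (∀ n, ‖x n‖ = 1) ∧ IsDisjointSeq x := by
  obtain ⟨y, hy, hd⟩ := exists_disjoint_seq_pos hE
  have hx : ∀ n, 0 ≤ ‖y n‖⁻¹ • y n := fun n => smul_nonneg (by positivity) (hy n).le
  have hlt : ∀ m n, m < n → (‖y m‖⁻¹ • y m) ⊓ (‖y n‖⁻¹ • y n) = 0 := fun m n hmn => by
    refine smul_inf_eq_zero (by positivity) (hy m).le (hx n) ?_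
    rw [inf_comm]
    refine smul_inf_eq_zero (by positivity) (hy n).le (hy m).le ?_
    rw [inf_comm, hd m n hmn]
  refine ⟨fun n => ‖y n‖⁻¹ • y n, hx, fun n => norm_smul_inv_norm (hy n).ne', fun m n hmn => ?_⟩
  rw [abs_of_nonneg (hx m), abs_of_nonneg (hx n)]
  rcases hmn.lt_or_gt with h | h
  · exact hlt m n h
  · rw [inf_comm]
    exact hlt n m h

end Atoms

/-! ### Positive norming functionals. -/

section Functionals

variable {E : Type*} [NormedAddCommGroup E] [NormedSpace ℝ E] [Lattice E]
  [IsOrderedModule ℝ E]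

theorem posPart_smul_le_smul_posPart {c : ℝ} (hc : 0 ≤ c) (x : E) : (c • x)⁺ ≤ c • x⁺ :=
  sup_le (smul_le_smul_of_nonneg_left (le_posPart x) hc) (smul_nonneg hc (posPart_nonneg x))

theorem norm_posPart_smul {c : ℝ} (hc : 0 < c) (x : E) : ‖(c • x)⁺‖ = c * ‖x⁺‖ := by
  have h : (c • x)⁺ = c • x⁺ := by
    refine le_antisymm (posPart_smul_le_smul_posPart hc.le x) ?_
    have := posPart_smul_le_smul_posPart (inv_nonneg.mpr hc.le) (c • x)
    rw [inv_smul_smul₀ hc.ne'] at this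
    exact (le_inv_smul_iff_of_pos hc).mp this
  rw [h, norm_smul, Real.norm_of_nonneg hc.le]

variable [IsOrderedAddMonoid E] [HasSolidNorm E]

/-- Every positive vector is normed by a positive contractive functional. -/
theorem exists_positive_functional_apply_eq_norm {x : E} (hx : 0 ≤ x) :
    ∃ f : E →ₗ[ℝ] ℝ, (∀ y, 0 ≤ y → 0 ≤ f y) ∧ (∀ y, |f y| ≤ ‖y‖) ∧ f x = ‖x‖ := by
  rcases eq_or_ne x 0 with rfl | hx0
  · exact ⟨0, by simp⟩
  have hle : ∀ y : E, ‖y⁺‖ ≤ ‖y‖ := fun y => by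
    refine norm_le_norm_of_abs_le_abs ?_
    rw [abs_of_nonneg (posPart_nonneg y)]
    exact sup_le (le_abs_self y) (abs_nonneg y)
  -- Hahn–Banach with `‖y⁺‖` in place of `‖y‖` forces positivity, as `(-y)⁺ = 0` for `y ≥ 0`.
  obtain ⟨f, hfx, hf⟩ := exists_extension_of_le_sublinear
    (LinearPMap.mkSpanSingleton x ‖x‖ hx0) (fun y => ‖y⁺‖)
    (fun c hc y => norm_posPart_smul hc y)
    (fun y z => (norm_le_norm_of_nonneg_of_le (posPart_nonneg _)
      (sup_le (add_le_add (le_posPart y) (le_posPart z))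
        (add_nonneg (posPart_nonneg y) (posPart_nonneg z)))).trans (norm_add_le _ _))
    (by
      rintro ⟨y, hy⟩
      obtain ⟨c, rfl⟩ := Submodule.mem_span_singleton.mp hy
      refine (LinearPMap.mkSpanSingleton'_apply x ‖x‖ _ c hy).trans_le ?_
      rw [RingHom.id_apply, smul_eq_mul]
      rcases le_or_gt c 0 with hc | hc
      · exact (mul_nonpos_of_nonpos_of_nonneg hc (norm_nonneg x)).trans (norm_nonneg _)
      · dsimp only
        rw [norm_posPart_smul hc, posPart_eq_self.mpr hx])
  refine ⟨f, fun y hy => ?_, fun y => abs_le.mpr ⟨?_, (hf y).trans (hle y)⟩, ?_⟩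
  · have := hf (-y)
    rw [map_neg, posPart_eq_zero.mpr (neg_nonpos.mpr hy), norm_zero] at this
    linarith
  · have := (hf (-y)).trans (hle (-y))
    rw [map_neg, norm_neg] at this
    linarith
  · have := hfx ⟨x, Submodule.mem_span_singleton_self x⟩
    rw [this]
    exact LinearPMap.mkSpanSingleton_apply ℝ ℝ hx0 ‖x‖

end Functionals

/-! ### Operators and disjoint sequences in `ℓ_∞`. -/

section EllInfty

variable {E : Type*} [NormedAddCommGroup E] [NormedSpace ℝ E]

/-- The operator into `ℓ_∞` whose coordinates are given contractive functionals. -/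
noncomputable def toEllInfty (f : ℕ → E →ₗ[ℝ] ℝ) (hf : ∀ n y, |f n y| ≤ ‖y‖) :
    E →L[ℝ] EllInfty :=
  LinearMap.mkContinuous
    { toFun := fun y =>
        BoundedContinuousFunction.ofNormedAddCommGroupDiscrete (fun n => f n y) ‖y‖
          fun n => hf n y
      map_add' := fun y z => by ext n; simp
      map_smul' := fun c y => by ext n; simp } 1
    fun y => by
      rw [one_mul]
      exact (BoundedContinuousFunction.norm_le (norm_nonneg y)).mpr fun n => hf n y

theorem toEllInfty_apply (f : ℕ → E →ₗ[ℝ] ℝ) (hf : ∀ n y, |f n y| ≤ ‖y‖) (y : E) (n : ℕ) :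
    toEllInfty f hf y n = f n y := rfl

/-- At each coordinate at most one term is nonzero. -/
theorem IsDisjointSeq.sum_abs_apply_le {x : ℕ → EllInfty} (hx : IsDisjointSeq x) {C : ℝ}
    (hC : ∀ n, ‖x n‖ ≤ C) (s : Finset ℕ) (k : ℕ) : ∑ n ∈ s, |x n k| ≤ C := by
  have hC0 : 0 ≤ C := (norm_nonneg _).trans (hC 0)
  by_cases h : ∃ m ∈ s, x m k ≠ 0
  · obtain ⟨m, hm, hmk⟩ := h
    rw [Finset.sum_eq_single_of_mem m hm]
    · exact ((x m).norm_coe_le_norm k).trans (hC m)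
    · intro n _ hnm
      have h1 : |x n k| ⊓ |x m k| = 0 := by
        simpa using DFunLike.congr_fun (hx hnm) k
      rcases min_choice |x n k| |x m k| with h2 | h2
      · exact h2.symm.trans h1
      · exact absurd (abs_eq_zero.mp (h2.symm.trans h1)) hmk
  · push Not at h
    rw [Finset.sum_eq_zero fun n hn => by rw [h n hn, abs_zero]]
    exact hC0

/-- Bounded disjoint sequences in `ℓ_∞` are weakly null. -/
theorem IsDisjointSeq.isWeaklyNull {x : ℕ → EllInfty} (hx : IsDisjointSeq x) {C : ℝ}
    (hC : ∀ n, ‖x n‖ ≤ C) : IsWeaklyNull x := by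
  have hC0 : 0 ≤ C := (norm_nonneg _).trans (hC 0)
  have key : ∀ f : EllInfty →L[ℝ] ℝ, Tendsto (fun n => f (x n)) atTop (𝓝 0) := by
    intro f
    have hsum : Summable fun n => |f (x n)| := by
      refine summable_of_sum_le (c := ‖f‖ * C) (fun n => abs_nonneg _) fun s => ?_
      -- Disjointness keeps every signed sum within norm `C`, so the partial sums of `|f (x n)|`
      -- stay below `‖f‖ * C`.
      have heq : ∑ n ∈ s, |f (x n)| = f (∑ n ∈ s, (SignType.sign (f (x n)) : ℝ) • x n) := by
        simp [map_sum, sign_mul_self]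
      rw [heq]
      refine (le_abs_self _).trans ((f.le_opNorm _).trans
        (mul_le_mul_of_nonneg_left ?_ (norm_nonneg f)))
      refine (BoundedContinuousFunction.norm_le hC0).mpr fun k => ?_
      have hcoe : (∑ n ∈ s, (SignType.sign (f (x n)) : ℝ) • x n) k =
          ∑ n ∈ s, (SignType.sign (f (x n)) : ℝ) * x n k := by
        simp
      rw [hcoe]
      refine (norm_sum_le _ _).trans ((Finset.sum_le_sum fun n _ => ?_).trans
        (hx.sum_abs_apply_le hC s k))
      rw [norm_mul, Real.norm_eq_abs, Real.norm_eq_abs]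
      refine mul_le_of_le_one_left (abs_nonneg _) ?_
      rcases SignType.sign (f (x n)) <;> simp
    exact (tendsto_zero_iff_abs_tendsto_zero _).mpr hsum.tendsto_atTop_zero
  refine (WeakBilin.tendsto_iff_forall_eval_tendsto _ ?_).mpr fun f => ?_
  · intro a b hab
    by_contra hne
    obtain ⟨f, hf⟩ := SeparatingDual.exists_separating_of_ne (R := ℝ) hne
    exact hf (DFunLike.congr_fun hab f)
  · have h := key f
    rw [← map_zero f] at h
    exact h

theorem isDisjointlyWeaklyCompact_ellInfty {X : Type*} [NormedAddCommGroup X] [NormedSpace ℝ X]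
    (T : X →L[ℝ] EllInfty) : IsDisjointlyWeaklyCompact T := by
  refine ⟨T.lipschitz.isBounded_image Metric.isBounded_closedBall, fun x hx hmem => ?_⟩
  refine hx.isWeaklyNull (C := ‖T‖) fun n => ?_
  obtain ⟨_, ⟨y, hy, rfl⟩, hle⟩ := hmem n
  refine (norm_le_norm_of_abs_le_abs hle).trans (T.unit_le_opNorm y ?_)
  simpa using hy

end EllInfty

theorem theorem4p12 {E : Type*} [NormedAddCommGroup E] [NormedSpace ℝ E] [CompleteSpace E]
    [Lattice E] [IsOrderedAddMonoid E] [IsOrderedModule ℝ E] [HasSolidNorm E] :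
    FiniteDimensional ℝ E ↔
      ∀ T : E →L[ℝ] EllInfty,
        IsPositiveOperator T → IsDisjointlyWeaklyCompact T → IsMWeaklyCompact T := by
  constructor
  · intro _ T _ _ x _ hx
    refine tendsto_const_nhds.congr' ?_
    filter_upwards [hx.eventually_eq_zero] with n hn
    rw [hn, map_zero, norm_zero]
  · intro h
    by_contra hE
    obtain ⟨x, hx0, hx1, hxd⟩ := exists_isDisjointSeq_norm_eq_one hE
    choose f hfpos hfle hfx using fun n => exists_positive_functional_apply_eq_norm (hx0 n)
    have hbdd : Bornology.IsBounded (Set.range x) :=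
      isBounded_iff_forall_norm_le.mpr ⟨1, by rintro _ ⟨n, rfl⟩; exact (hx1 n).le⟩
    have hlim := h (toEllInfty f hfle) (fun y hy n => hfpos n y hy)
      (isDisjointlyWeaklyCompact_ellInfty _) x hbdd hxd
    have hge : ∀ n, 1 ≤ ‖toEllInfty f hfle (x n)‖ := fun n => by
      have h1 := (toEllInfty f hfle (x n)).norm_coe_le_norm n
      rw [toEllInfty_apply, hfx, hx1] at h1
      simpa using h1
    exact absurd (ge_of_tendsto' hlim hge) (by norm_num)
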